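/- Let $V\neq 0$ be a finite-dimensional real vector space with a finite increasing filtration $W$ (so $W_k=0$ for $k\ll0$ and $W_k=V$ for $k\gg0$), let $\langle\,,\rangle_w$ be non-degenerate bilinear forms on $Gr^W_w=W_w/W_{w-1}$, symmetric for $w$ even and antisymmetric for $w$ odd, and let $h^{p,q}=h^{q,p}\ge 0$ be integers with $\dim Gr^W_w=\sum_{p+q=w}h^{p,q}$ for all $w$. Let $\mathcal M$ be the set of all decreasing filtrations $F$ of $V_{\mathbb C}$ such that $(F,W)$ is a mixed Hodge structure and, for every $w$, $(Gr^W_w,F Gr^W_w)$ is a Hodge structure of weight $w$ with Hodge numbers $h^{p,q}$ $(p+q=w)$ polarized by $\langle\,,\rangle_w$ (with the sign convention $i^{p-q}\langle u,\bar u\rangle_w>0$ for $0\ne u$ of type $(p,q)$). For $F\in\mathcal M$ let $V_{\mathbb C}=\bigoplus I^{p,q}$ be the Deligne bigrading of $(F,W)$, i.e. the unique bigrading with $F^p=\bigoplus_{a\ge p}I^{a,b}$, $W_k=\bigoplus_{a+b\le k}I^{a,b}$ and $I^{p,q}\equiv\overline{I^{q,p}}$ modulo $\bigoplus_{r<p,\,s<q}I^{r,s}$,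 and let $h_F$ be the hermitian inner product on $V_{\mathbb C}$ for which the $I^{p,q}$ are mutually orthogonal and $h_F(u,v)=i^{p-q}\langle gr_{p+q}u,gr_{p+q}\bar v\rangle_{p+q}$ for $u,v\in I^{p,q}$. Let $G_{\mathbb C}$ be the group of automorphisms of $V_{\mathbb C}$ which preserve $W$ and act on each $Gr^W_{w,\mathbb C}$ by isometries of $\langle\,,\rangle_w$, let $\mathfrak g_{\mathbb C}$ be its Lie algebra, and let $\mathfrak g^{p,q}$ be the set of elements of $\mathfrak g_{\mathbb C}$ which map $I^{a,b}$ into $I^{a+p,b+q}$ for all $a,b$. The space $\mathcal M$ is an open subset of a homogeneous space of $G_{\mathbb C}$, and $T_F(\mathcal M)$ is identified with $\bigoplus_{p<0,\,p+q\le0}\mathfrak g^{p,q}$ by $v\mapsto\frac{d}{dt}e^{tv}.F|_{t=0}$. The standard metric on $\mathcal M$ is $h_F(\alpha,\beta)=\mathrm{Tr}(\alpha\beta^*)$ for $\alpha,\beta\in T_F(\mathcal M)$, where $\beta^*$ is the adjoint of $\beta$ with respect to $h_F$, and $d(F,F')\in[0,\infty]$ is the infimum of the lengths of the smooth curves in $\mathcal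 M$ from $F$ to $F'$ ($\infty$ if there are none). Let $Y$ be a real grading of $W$, i.e. a semisimple endomorphism $Y$ of $V$ such that, for every $k$, $W_k$ is the direct sum of $W_{k-1}$ and the $k$-eigenspace of $Y$. Let $\alpha<0$, $y>1$ and $y^{\alpha Y}=\exp(\alpha\log(y)\,Y)$, and let $L=\min\{k\mid W_k=V\}-\max\{k\mid W_k=0\}$ be the length of $W$. Then for all $F,F'\in\mathcal M$ the filtrations $y^{\alpha Y}.F$ and $y^{\alpha Y}.F'$ belong to $\mathcal M$, and $$d(y^{\alpha Y}.F,\;y^{\alpha Y}.F')\;\le\; y^{-\alpha(L-1)}\,d(F,F').$$ -/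

import Mathlib

open scoped TensorProduct ContDiff Topology
open Set

noncomputable section

namespace MixedHodge

/-! ### Complexification of real vector spaces -/

section Complexification

variable (U : Type*) [AddCommGroup U] [Module ℝ U]

/-- The complexification `U_ℂ = U ⊗ ℂ` of a real vector space. -/
abbrev Cx : Type _ := ℂ ⊗[ℝ] U

/-- Complex conjugation `z ⊗ u ↦ z̄ ⊗ u` on `U_ℂ`. -/
def conj : Cx U →ₛₗ[starRingEnd ℂ] Cx U where
  toFun := TensorProduct.map Complex.conjAe.toLinearMap (LinearMap.id : U →ₗ[ℝ] U)
  map_add' := map_add _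
  map_smul' := by
    intro c x
    induction x using TensorProduct.induction_on with
    | zero => simp
    | tmul z u => simp [TensorProduct.smul_tmul']
    | add a b ha hb => rw [smul_add, map_add, ha, hb, map_add, smul_add]

variable {U}

/-- The complex conjugate `{x | x̄ ∈ S}` of a complex subspace `S` of `U_ℂ`. -/
def conjSubspace (S : Submodule ℂ (Cx U)) : Submodule ℂ (Cx U) := S.comap (conj U)

end Complexification

/-- Polarized real Hodge structures of weight `w`: `Φ` is the Hodge filtration on `H_ℂ`,
`B` the (real) polarization; the Hodge component of type `(p,q)`, `p + q = w`, is
`Φ p ⊓ conj (Φ q)`. -/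
structure IsPolarizedHodgeStructure {H : Type*} [AddCommGroup H] [Module ℝ H] (w : ℤ)
    (B : LinearMap.BilinForm ℝ H) (Φ : ℤ → Submodule ℂ (Cx H)) : Prop where
  antitone : Antitone Φ
  exists_top : ∃ p, Φ p = ⊤
  exists_bot : ∃ p, Φ p = ⊥
  isCompl : ∀ p, IsCompl (Φ p) (conjSubspace (Φ (w + 1 - p)))
  orthogonal : ∀ p q, w < p + q → ∀ u ∈ Φ p, ∀ v ∈ Φ q, B.baseChange ℂ u v = 0
  positive : ∀ p q, p + q = w → ∀ u ∈ Φ p ⊓ conjSubspace (Φ q), u ≠ 0 →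
    0 < (Complex.I ^ (p - q) * B.baseChange ℂ u (conj H u)).re

variable {V : Type*} [AddCommGroup V] [Module ℝ V]

/-! ### Filtrations and graded quotients -/

/-- `Gr^W_w = W_w / W_{w-1}`. -/
abbrev Gr (W : ℤ → Submodule ℝ V) (w : ℤ) : Type _ :=
  (W w) ⧸ (W (w - 1)).submoduleOf (W w)

/-- The inclusion `(W_w)_ℂ → V_ℂ`. -/
def incl (W : ℤ → Submodule ℝ V) (w : ℤ) : Cx (W w) →ₗ[ℂ] Cx V :=
  (W w).subtype.baseChange ℂ

/-- The projection `(W_w)_ℂ → (Gr^W_w)_ℂ`. -/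
def gr (W : ℤ → Submodule ℝ V) (w : ℤ) : Cx (W w) →ₗ[ℂ] Cx (Gr W w) :=
  ((W (w - 1)).submoduleOf (W w)).mkQ.baseChange ℂ

/-- The filtration induced by `F` on `(Gr^W_w)_ℂ`. -/
def grFiltration (W : ℤ → Submodule ℝ V) (F : ℤ → Submodule ℂ (Cx V)) (w p : ℤ) :
    Submodule ℂ (Cx (Gr W w)) :=
  ((F p).comap (incl W w)).map (gr W w)

/-- The length `min {k | W_k = V} - max {k | W_k = 0}` of a filtration. -/
def filtrationLength (W : ℤ → Submodule ℝ V) : ℤ :=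
  sInf {k | W k = ⊤} - sSup {k | W k = ⊥}

/-- A real grading of `W`: a semisimple endomorphism `Y` of `V` such that `W_k` is the
direct sum of `W_{k-1}` and the `k`-eigenspace of `Y`, for every `k`. -/
structure IsRealGrading (W : ℤ → Submodule ℝ V) (Y : Module.End ℝ V) : Prop where
  isSemisimple : Y.IsSemisimple
  sup_eq : ∀ k : ℤ, W (k - 1) ⊔ Y.eigenspace (k : ℝ) = W k
  disjoint : ∀ k : ℤ, Disjoint (W (k - 1)) (Y.eigenspace (k : ℝ))

/-- The exponential of an endomorphism of a finite-dimensional real vector space, computed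
as a matrix exponential in a basis (it does not depend on the basis). -/
def expEnd [FiniteDimensional ℝ V] (X : Module.End ℝ V) : Module.End ℝ V :=
  Matrix.toLin (Module.finBasis ℝ V) (Module.finBasis ℝ V)
    (NormedSpace.exp (LinearMap.toMatrix (Module.finBasis ℝ V) (Module.finBasis ℝ V) X))

/-- `y ^ X = exp (log y • X)`. -/
def powEnd [FiniteDimensional ℝ V] (y : ℝ) (X : Module.End ℝ V) : Module.End ℝ V :=
  expEnd (Real.log y • X)

/-- The image `g.F` of a filtration of `V_ℂ` under an endomorphism `g` of `V_ℂ`. -/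
def act (g : Module.End ℂ (Cx V)) (F : ℤ → Submodule ℂ (Cx V)) : ℤ → Submodule ℂ (Cx V) :=
  fun p => (F p).map g

/-! ### The classifying space -/

/-- The data defining a classifying space of graded-polarized mixed Hodge structures on `V`:
a finite increasing filtration `W`, a nondegenerate `(-1)^w`-symmetric bilinear form on each
`Gr^W_w`, and Hodge numbers `h p q` (in weight `p + q`). -/
structure Data (V : Type*) [AddCommGroup V] [Module ℝ V] where
  W : ℤ → Submodule ℝ V
  monotone : Monotone W
  exists_bot : ∃ k, W k = ⊥
  exists_top : ∃ k, W k = ⊤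
  form : ∀ w : ℤ, LinearMap.BilinForm ℝ (Gr W w)
  nondegenerate : ∀ w, (form w).Nondegenerate
  symm_of_even : ∀ w, Even w → ∀ x y, form w x y = form w y x
  antisymm_of_odd : ∀ w, Odd w → ∀ x y, form w x y = -form w y x
  h : ℤ → ℤ → ℕ
  h_symm : ∀ p q, h p q = h q p
  h_finite : ∀ w, {p : ℤ | h p (w - p) ≠ 0}.Finite
  finrank_gr : ∀ w, Module.finrank ℝ (Gr W w) = ∑ᶠ p : ℤ, h p (w - p)

namespace Data

variable (D : Data V)

/-- The classifying space `ℳ`: the set of all (finite) decreasing filtrations `F` of `V_ℂ`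
such that `(F, W)` induces on every `Gr^W_w` a Hodge structure of weight `w` (so that `(F, W)`
is a mixed Hodge structure) which is polarized by the given form and has the given Hodge
numbers. -/
def M : Set (ℤ → Submodule ℂ (Cx V)) :=
  {F | Antitone F ∧ (∃ p, F p = ⊤) ∧ (∃ p, F p = ⊥) ∧
    ∀ w, IsPolarizedHodgeStructure w (D.form w) (grFiltration D.W F w) ∧
      ∀ p q, p + q = w →
        Module.finrank ℂ ↥(grFiltration D.W F w p ⊓ conjSubspace (grFiltration D.W F w q))
          = D.h p q}

/-- The group `G_ℂ` of the automorphisms of `V_ℂ` which preserve `W` and induce isometries of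
every `(Gr^W_w)_ℂ`. -/
def GC : Set (Cx V ≃ₗ[ℂ] Cx V) :=
  {g | (∀ w, ((D.W w).baseChange ℂ).map (g : Module.End ℂ (Cx V)) = (D.W w).baseChange ℂ) ∧
    ∀ w, ∀ u v u' v' : Cx (D.W w),
      incl D.W w u' = g (incl D.W w u) → incl D.W w v' = g (incl D.W w v) →
        (D.form w).baseChange ℂ (gr D.W w u') (gr D.W w v')
          = (D.form w).baseChange ℂ (gr D.W w u) (gr D.W w v)}

/-- Membership in the Lie algebra `𝔤_ℂ` of `G_ℂ`. -/
def IsInLieAlgebra (X : Module.End ℂ (Cx V)) : Prop :=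
  (∀ w, ((D.W w).baseChange ℂ).map X ≤ (D.W w).baseChange ℂ) ∧
    ∀ w, ∀ u v u' v' : Cx (D.W w),
      incl D.W w u' = X (incl D.W w u) → incl D.W w v' = X (incl D.W w v) →
        (D.form w).baseChange ℂ (gr D.W w u') (gr D.W w v)
          + (D.form w).baseChange ℂ (gr D.W w u) (gr D.W w v') = 0

/-- `I` is the Deligne bigrading of the mixed Hodge structure `(F, W)`
(by a theorem of Deligne it exists and is unique). -/
structure IsDeligneBigrading (F : ℤ → Submodule ℂ (Cx V)) (I : ℤ → ℤ → Submodule ℂ (Cx V)) :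
    Prop where
  isInternal : DirectSum.IsInternal fun pq : ℤ × ℤ => I pq.1 pq.2
  hodge : ∀ p, F p = ⨆ (a : ℤ) (b : ℤ) (_ : p ≤ a), I a b
  weight : ∀ k, (D.W k).baseChange ℂ = ⨆ (a : ℤ) (b : ℤ) (_ : a + b ≤ k), I a b
  conj_mod : ∀ p q,
    I p q ⊔ (⨆ (r : ℤ) (s : ℤ) (_ : r < p ∧ s < q), I r s)
      = conjSubspace (I q p) ⊔ (⨆ (r : ℤ) (s : ℤ) (_ : r < p ∧ s < q), I r s)

/-- The mixed Hodge metric attached to the Deligne bigrading `I`: the hermitian inner product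
`h` on `V_ℂ` for which the bigrading is orthogonal and such that
`h(u,v) = i^{p-q} ⟨gr u, gr v̄⟩_{p+q}` for `u, v ∈ I^{p,q}`. The form `h` is linear in the
first variable, whereas `c.inner` is linear in the second one, so `h(u,v) = c.inner v u`. -/
structure IsMixedHodgeMetric (I : ℤ → ℤ → Submodule ℂ (Cx V))
    (c : InnerProductSpace.Core ℂ (Cx V)) : Prop where
  orthogonal : ∀ p q p' q', (p, q) ≠ (p', q') → ∀ u ∈ I p q, ∀ v ∈ I p' q', c.inner v u = 0
  inner_eq : ∀ p q, ∀ u v : Cx (D.W (p + q)),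
    incl D.W (p + q) u ∈ I p q → incl D.W (p + q) v ∈ I p q →
      c.inner (incl D.W (p + q) v) (incl D.W (p + q) u)
        = Complex.I ^ (p - q) *
          (D.form (p + q)).baseChange ℂ (gr D.W (p + q) u) (gr D.W (p + q) (conj _ v))

/-- The component `𝔤^{p,q}` of `𝔤_ℂ`: the elements which map `I^{a,b}` to `I^{a+p,b+q}`. -/
def lieComponent (I : ℤ → ℤ → Submodule ℂ (Cx V)) (p q : ℤ) :
    Set (Module.End ℂ (Cx V)) :=
  {X | D.IsInLieAlgebra X ∧ ∀ a b, (I a b).map X ≤ I (a + p) (b + q)}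

/-- The subspace `⨁_{p<0, p+q≤0} 𝔤^{p,q}`, a model of the tangent space `T_F(ℳ)` when `I` is
the Deligne bigrading of `(F, W)`. -/
def tangentModel (I : ℤ → ℤ → Submodule ℂ (Cx V)) : Submodule ℂ (Module.End ℂ (Cx V)) :=
  Submodule.span ℂ (⋃ (p : ℤ) (q : ℤ) (_ : p < 0 ∧ p + q ≤ 0), D.lieComponent I p q)

end Data

/-- The hermitian form `(a, b) ↦ Tr (a b^*)` on endomorphisms of `E`, where `b^*` is the
adjoint of `b` with respect to the hermitian inner product `c` on `E`. -/
def traceForm {E : Type*} [AddCommGroup E] [Module ℂ E] [FiniteDimensional ℂ E]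
    (c : InnerProductSpace.Core ℂ E) (a b : Module.End ℂ E) : ℂ :=
  letI : NormedAddCommGroup E := c.toNormedAddCommGroup
  letI : InnerProductSpace ℂ E := InnerProductSpace.ofCore c.toCore
  LinearMap.trace ℂ E (a * LinearMap.adjoint b)

namespace Data

variable (D : Data V)

/-- The curve `γ`, defined on `[0,1]`, is smooth near `u` with values in a single orbit of
`G_ℂ`, and has there the velocity `d/ds (e^{sv}.γ(u))|_{s=0}`: near `u`, `γ(t) = g(t).γ(u)` for
a smooth (in terms of matrix coefficients) curve `g` in `G_ℂ` with `g(u) = 1`, `g'(u) = v`. -/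
def HasVelocity (γ : ℝ → ℤ → Submodule ℂ (Cx V)) (u : ℝ) (v : Module.End ℂ (Cx V)) : Prop :=
  ∃ g : ℝ → (Cx V ≃ₗ[ℂ] Cx V),
    (∀ᶠ t in 𝓝[Icc 0 1] u, g t ∈ D.GC ∧ γ t = act (g t : Module.End ℂ (Cx V)) (γ u)) ∧
    g u = LinearEquiv.refl ℂ (Cx V) ∧
    (∀ (φ : Module.Dual ℂ (Cx V)) (x : Cx V),
      ContDiffWithinAt ℝ ∞ (fun t => φ (g t x)) (Icc 0 1) u) ∧
    ∀ (φ : Module.Dual ℂ (Cx V)) (x : Cx V),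
      HasDerivWithinAt (fun t => φ (g t x)) (φ (v x)) (Icc 0 1) u

variable [FiniteDimensional ℝ V]

/-- The curve `γ` is smooth near `u`, and `s = ‖γ'(u)‖` is the length of its velocity for the
standard metric `h_F(a,b) = Tr (a b^*)` on `T_F(ℳ)`, `F = γ(u)`. Here the bigrading `I`, the
inner product `c` and the representative `v` of `γ'(u)` are uniquely determined. -/
def HasSpeed (γ : ℝ → ℤ → Submodule ℂ (Cx V)) (u s : ℝ) : Prop :=
  ∃ (I : ℤ → ℤ → Submodule ℂ (Cx V)) (c : InnerProductSpace.Core ℂ (Cx V))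
    (v : Module.End ℂ (Cx V)),
    D.IsDeligneBigrading (γ u) I ∧ D.IsMixedHodgeMetric I c ∧ v ∈ D.tangentModel I ∧
      D.HasVelocity γ u v ∧ s = √(traceForm c v v).re

/-- The distance on `ℳ` defined by the standard metric: the infimum of the lengths
`∫₀¹ ‖γ'(u)‖ du` of the smooth curves in `ℳ` from `F` to `F'` (it is `∞` if there is no such
curve, that is, if `F` and `F'` lie in different connected components of `ℳ`). -/
def dist (F F' : ℤ → Submodule ℂ (Cx V)) : ENNReal :=
  ⨅ (γ : ℝ → ℤ → Submodule ℂ (Cx V)) (s : ℝ → ℝ)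
    (_ : γ 0 = F ∧ γ 1 = F' ∧ ∀ u ∈ Icc (0 : ℝ) 1, γ u ∈ D.M ∧ D.HasSpeed γ u (s u)),
    ∫⁻ u in Icc (0 : ℝ) 1, ENNReal.ofReal (s u)

end Data

end MixedHodge

end

/-!
The automorphism `g = exp (r Y)` acts on `Gr^W_k` as the scalar `c k = e^{rk}`. Every filtration of
`Gr^W_k` is stable under scalars, so `g` maps `ℳ` to itself; as `g` is real and preserves `W`, it
carries the Deligne bigrading `I` of `F` to the Deligne bigrading `g I` of `g.F`. Since
`⟨gr (g u), gr (g v)⟩ = (c k)² ⟨gr u, gr v⟩` in weight `k`, the mixed Hodge metric of `g.F` is the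
pullback of that of `F` along `δ g⁻¹`, where `δ` acts on `I^{p,q}` as `c (p + q)`. Therefore the
image `g v g⁻¹` of a tangent vector `v` at `F` has the length of `δ v δ⁻¹` at `F`. In an orthonormal
basis adapted to the `I^{p,q}` the matrix of `δ v δ⁻¹` is that of `v` with entries multiplied by
factors `c k / c l = e^{r(k - l)}`, where `k` and `l` are weights occurring in `V`, so that
`|k - l| ≤ L - 1`. Hence `g` stretches lengths of curves at most by `e^{|r|(L - 1)}`.
-/

noncomputable section

namespace MixedHodge

section Exponential

theorem exp_mulVec_of_mulVec_eq_smul {𝕜 n : Type*} [RCLike 𝕜] [Fintype n] [DecidableEq n]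
    {A : Matrix n n 𝕜} {v : n → 𝕜} {μ : 𝕜} (h : A.mulVec v = μ • v) :
    (NormedSpace.exp A).mulVec v = NormedSpace.exp μ • v := by
  have pow_mulVec (k : ℕ) : (A ^ k).mulVec v = μ ^ k • v := by
    induction k with
    | zero => simp
    | succ k ih =>
      rw [pow_succ', ← Matrix.mulVec_mulVec, ih, Matrix.mulVec_smul, h, smul_smul, pow_succ]
  have hasSum_exp : HasSum (fun k : ℕ => (k.factorial : 𝕜)⁻¹ • A ^ k) (NormedSpace.exp A) :=
    open scoped Matrix.Norms.Operator in NormedSpace.exp_series_hasSum_exp' A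
  have hasSum_exp_mulVec := hasSum_exp.map (Matrix.mulVec.addMonoidHomLeft v)
    (continuous_id.matrix_mulVec continuous_const)
  refine hasSum_exp_mulVec.unique ?_
  convert (NormedSpace.exp_series_hasSum_exp' (𝕂 := 𝕜) μ).smul_const v using 1
  funext k
  change ((k.factorial : 𝕜)⁻¹ • A ^ k).mulVec v = _
  rw [Matrix.smul_mulVec, pow_mulVec, smul_assoc]

variable {V : Type*} [AddCommGroup V] [Module ℝ V] [FiniteDimensional ℝ V]

theorem expEnd_apply_of_apply_eq_smul {X : Module.End ℝ V} {x : V} {μ : ℝ}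
    (h : X x = μ • x) : expEnd X x = Real.exp μ • x := by
  let b := Module.finBasis ℝ V
  have h_coord : (LinearMap.toMatrix b b X).mulVec (b.repr x) = μ • ⇑(b.repr x) := by
    rw [LinearMap.toMatrix_mulVec_repr, h, map_smul, Finsupp.coe_smul]
  refine b.repr.injective (DFunLike.coe_injective ?_)
  rw [map_smul, Finsupp.coe_smul, Real.exp_eq_exp_ℝ, ← exp_mulVec_of_mulVec_eq_smul h_coord,
    ← LinearMap.toMatrix_mulVec_repr b b]
  simp only [expEnd, b, LinearMap.toMatrix_toLin]

theorem expEnd_comp_expEnd_neg (X : Module.End ℝ V) :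
    expEnd X ∘ₗ expEnd (-X) = LinearMap.id := by
  let b := Module.finBasis ℝ V
  have h_comm : Commute (LinearMap.toMatrix b b X) (-LinearMap.toMatrix b b X) :=
    (Commute.refl _).neg_right
  rw [expEnd, expEnd, ← Matrix.toLin_mul, map_neg, ← Matrix.exp_add_of_commute _ _ h_comm,
    add_neg_cancel, NormedSpace.exp_zero, Matrix.toLin_one]

/-- The exponential of an endomorphism as an automorphism. -/
def expEquiv (X : Module.End ℝ V) : V ≃ₗ[ℝ] V :=
  LinearEquiv.ofLinearMap (expEnd X) (expEnd (-X)) (expEnd_comp_expEnd_neg X)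
    (by simpa only [neg_neg] using expEnd_comp_expEnd_neg (-X))

theorem expEquiv_smul_apply_of_mem_eigenspace {X : Module.End ℝ V} {μ : ℝ} {x : V}
    (hx : x ∈ X.eigenspace μ) (r : ℝ) : expEquiv (r • X) x = Real.exp (r * μ) • x :=
  expEnd_apply_of_apply_eq_smul <| by
    rw [LinearMap.smul_apply, Module.End.mem_eigenspace_iff.1 hx, smul_smul]

theorem map_eigenspace_expEquiv_smul (X : Module.End ℝ V) (r μ : ℝ) :
    (X.eigenspace μ).map (expEquiv (r • X)).toLinearMap = X.eigenspace μ := by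
  refine le_antisymm (Submodule.map_le_iff_le_comap.2 fun x hx => ?_) fun x hx => ?_
  · rw [Submodule.mem_comap, LinearEquiv.coe_coe, expEquiv_smul_apply_of_mem_eigenspace hx]
    exact Submodule.smul_mem _ _ hx
  · refine ⟨(Real.exp (r * μ))⁻¹ • x, Submodule.smul_mem _ _ hx, ?_⟩
    rw [map_smul, LinearEquiv.coe_coe, expEquiv_smul_apply_of_mem_eigenspace hx,
      inv_smul_smul₀ (Real.exp_ne_zero _)]

end Exponential

section WeightScaling

variable {V : Type*} [AddCommGroup V] [Module ℝ V] {W : ℤ → Submodule ℝ V}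

/-- The automorphism `g` preserves `W` and acts on each `Gr^W_k` as multiplication by the nonzero
scalar `c k`. -/
structure IsWeightScaling (W : ℤ → Submodule ℝ V) (c : ℤ → ℝ) (g : V ≃ₗ[ℝ] V) : Prop where
  ne_zero : ∀ k, c k ≠ 0
  map_eq : ∀ k, (W k).map g.toLinearMap = W k
  sub_mem : ∀ k, ∀ x ∈ W k, g x - c k • x ∈ W (k - 1)

namespace IsRealGrading

variable {Y : Module.End ℝ V}

theorem monotone (hY : IsRealGrading W Y) : Monotone W :=
  monotone_int_of_le_succ fun k => by
    rw [← hY.sup_eq (k + 1), add_sub_cancel_right]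
    exact le_sup_left

variable [FiniteDimensional ℝ V]

theorem map_expEquiv_smul (hY : IsRealGrading W Y) (hbot : ∃ k, W k = ⊥) (r : ℝ) (k : ℤ) :
    (W k).map (expEquiv (r • Y)).toLinearMap = W k := by
  obtain ⟨k₀, hk₀⟩ := hbot
  have map_eq_of_eq_bot {k : ℤ} (hk : W k = ⊥) :
      (W k).map (expEquiv (r • Y)).toLinearMap = W k := by
    rw [hk, Submodule.map_bot]
  rcases le_total k k₀ with hk | hk
  · exact map_eq_of_eq_bot (eq_bot_mono (hY.monotone hk) hk₀)
  · induction k, hk using Int.leInduction with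
    | base => exact map_eq_of_eq_bot hk₀
    | succ k _ ih =>
      rw [← hY.sup_eq (k + 1), add_sub_cancel_right, Submodule.map_sup, ih,
        map_eigenspace_expEquiv_smul]

theorem isWeightScaling_expEquiv_smul (hY : IsRealGrading W Y) (hbot : ∃ k, W k = ⊥) (r : ℝ) :
    IsWeightScaling W (fun k => Real.exp (r * k)) (expEquiv (r • Y)) where
  ne_zero k := Real.exp_ne_zero _
  map_eq := hY.map_expEquiv_smul hbot r
  sub_mem k x hx := by
    rw [← hY.sup_eq] at hx
    obtain ⟨a, ha, e, he, rfl⟩ := Submodule.mem_sup.1 hx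
    rw [map_add, expEquiv_smul_apply_of_mem_eigenspace he, smul_add, add_sub_add_right_eq_sub]
    refine sub_mem ?_ (Submodule.smul_mem _ _ ha)
    rw [← hY.map_expEquiv_smul hbot r]
    exact Submodule.mem_map_of_mem ha

end IsRealGrading

end WeightScaling

section Complexification

variable {U U' : Type*} [AddCommGroup U] [Module ℝ U] [AddCommGroup U'] [Module ℝ U']

/-- The extension of a real isomorphism to the complexifications. -/
abbrev cxEquiv (g : U ≃ₗ[ℝ] U') : Cx U ≃ₗ[ℂ] Cx U' := g.baseChange ℝ ℂ U U'

theorem conj_baseChange (f : U →ₗ[ℝ] U') (x : Cx U) :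
    conj U' (f.baseChange ℂ x) = f.baseChange ℂ (conj U x) := by
  induction x using TensorProduct.induction_on with
  | zero => simp only [map_zero]
  | tmul z u => rfl
  | add a b ha hb => simp only [map_add, ha, hb]

theorem conj_cxEquiv (g : U ≃ₗ[ℝ] U') (x : Cx U) :
    conj U' (cxEquiv g x) = cxEquiv g (conj U x) :=
  conj_baseChange g.toLinearMap x

theorem toLinearMap_cxEquiv_expEquiv [FiniteDimensional ℝ U] (X : Module.End ℝ U) :
    (cxEquiv (expEquiv X)).toLinearMap = (expEnd X).baseChange ℂ :=
  rfl

theorem conjSubspace_map_cxEquiv (g : U ≃ₗ[ℝ] U') (S : Submodule ℂ (Cx U)) :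
    conjSubspace (S.map (cxEquiv g).toLinearMap)
      = (conjSubspace S).map (cxEquiv g).toLinearMap := by
  ext x
  obtain ⟨x, rfl⟩ := (cxEquiv g).surjective x
  simp only [conjSubspace, Submodule.mem_comap, conj_cxEquiv, Submodule.mem_map_equiv,
    LinearEquiv.symm_apply_apply]

end Complexification

namespace IsWeightScaling

variable {V : Type*} [AddCommGroup V] [Module ℝ V] {W : ℤ → Submodule ℝ V} {c : ℤ → ℝ}
  {g : V ≃ₗ[ℝ] V}

/-- The automorphism of `W_w` induced by `g`. -/
def restrict (hg : IsWeightScaling W c g) (w : ℤ) : W w ≃ₗ[ℝ] W w :=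
  g.ofSubmodules (W w) (W w) (hg.map_eq w)

theorem incl_restrict (hg : IsWeightScaling W c g) (w : ℤ) (u : Cx (W w)) :
    incl W w (cxEquiv (hg.restrict w) u) = cxEquiv g (incl W w u) := by
  induction u using TensorProduct.induction_on with
  | zero => simp only [map_zero]
  | tmul z u => rfl
  | add a b ha hb => simp only [map_add, ha, hb]

theorem gr_restrict (hg : IsWeightScaling W c g) (w : ℤ) (u : Cx (W w)) :
    gr W w (cxEquiv (hg.restrict w) u) = (c w : ℂ) • gr W w u := by
  have mkQ_restrict (x : W w) :
      ((W (w - 1)).submoduleOf (W w)).mkQ (hg.restrict w x)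
        = c w • ((W (w - 1)).submoduleOf (W w)).mkQ x := by
    rw [← map_smul, Submodule.mkQ_apply, Submodule.mkQ_apply, Submodule.Quotient.eq]
    exact hg.sub_mem w x x.2
  induction u using TensorProduct.induction_on with
  | zero => simp only [map_zero, smul_zero]
  | tmul z u =>
    change z ⊗ₜ[ℝ] ((W (w - 1)).submoduleOf (W w)).mkQ (hg.restrict w u) = _
    rw [mkQ_restrict, ← TensorProduct.smul_tmul, Complex.real_smul]
    rfl
  | add a b ha hb => simp only [map_add, ha, hb, smul_add]

theorem map_baseChange (hg : IsWeightScaling W c g) (w : ℤ) :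
    ((W w).baseChange ℂ).map (cxEquiv g).toLinearMap = (W w).baseChange ℂ := by
  change (LinearMap.range (incl W w)).map _ = LinearMap.range (incl W w)
  have incl_comp : (cxEquiv g).toLinearMap ∘ₗ incl W w
      = incl W w ∘ₗ (cxEquiv (hg.restrict w)).toLinearMap :=
    LinearMap.ext fun u => (hg.incl_restrict w u).symm
  rw [← LinearMap.range_comp, incl_comp, LinearMap.range_comp_of_range_eq_top _
    (cxEquiv (hg.restrict w)).range]

theorem grFiltration_act (hg : IsWeightScaling W c g) (F : ℤ → Submodule ℂ (Cx V)) :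
    grFiltration W (act (cxEquiv g).toLinearMap F) = grFiltration W F := by
  funext w p
  have comap_incl : (act (cxEquiv g).toLinearMap F p).comap (incl W w)
      = ((F p).comap (incl W w)).map (cxEquiv (hg.restrict w)).toLinearMap := by
    ext u
    obtain ⟨u, rfl⟩ := (cxEquiv (hg.restrict w)).surjective u
    simp only [act, Submodule.mem_comap, hg.incl_restrict, Submodule.mem_map_equiv,
      LinearEquiv.symm_apply_apply]
  have gr_comp : gr W w ∘ₗ (cxEquiv (hg.restrict w)).toLinearMap = (c w : ℂ) • gr W w :=
    LinearMap.ext fun u => hg.gr_restrict w u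
  rw [grFiltration, comap_incl, ← Submodule.map_comp, gr_comp,
    Submodule.map_smul _ _ _ (Complex.ofReal_ne_zero.2 (hg.ne_zero w)), grFiltration]

theorem baseChange_gr_restrict (hg : IsWeightScaling W c g) (w : ℤ)
    (B : LinearMap.BilinForm ℝ (Gr W w)) (u v : Cx (W w)) :
    B.baseChange ℂ (gr W w (cxEquiv (hg.restrict w) u)) (gr W w (cxEquiv (hg.restrict w) v))
      = (c w : ℂ) ^ 2 * B.baseChange ℂ (gr W w u) (gr W w v) := by
  simp only [hg.gr_restrict, map_smul, LinearMap.smul_apply, smul_eq_mul]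
  ring

end IsWeightScaling

section HilbertSchmidt

variable {𝕜 E ι : Type*} [RCLike 𝕜] [NormedAddCommGroup E] [InnerProductSpace 𝕜 E]
  [FiniteDimensional 𝕜 E]

theorem re_trace_mul_adjoint_self [Fintype ι] (b : OrthonormalBasis ι 𝕜 E) (a : Module.End 𝕜 E) :
    RCLike.re (LinearMap.trace 𝕜 E (a * LinearMap.adjoint a))
      = ∑ j, ∑ i, ‖inner 𝕜 (b i) (a (b j))‖ ^ 2 := by
  rw [LinearMap.trace_mul_comm, LinearMap.trace_eq_sum_inner _ b, map_sum]
  refine Finset.sum_congr rfl fun j _ => ?_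
  rw [Module.End.mul_apply, LinearMap.adjoint_inner_right, inner_self_eq_norm_sq,
    b.sum_sq_norm_inner_right]

variable [DecidableEq ι] {A : ι → Submodule 𝕜 E}

theorem exists_orthonormalBasis_subordinate (hA : DirectSum.IsInternal A)
    (hO : OrthogonalFamily 𝕜 (fun i => A i) fun i => (A i).subtypeₗᵢ) :
    ∃ (b : OrthonormalBasis (Fin (Module.finrank 𝕜 E)) 𝕜 E)
      (k : Fin (Module.finrank 𝕜 E) → ι), ∀ j, b j ∈ A (k j) := by
  let _ : Fintype {i // A i ≠ ⊥} :=
    (WellFoundedGT.finite_ne_bot_of_iSupIndep hA.submodule_iSupIndep).fintype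
  have hA' := DirectSum.isInternal_ne_bot_iff.2 hA
  have hO' := hO.comp (Subtype.val_injective (p := fun i => A i ≠ ⊥))
  exact ⟨hA'.subordinateOrthonormalBasis rfl hO',
    fun j => (hA'.subordinateOrthonormalBasisIndex rfl j hO').1,
    fun j => hA'.subordinateOrthonormalBasis_subordinate rfl j hO'⟩

theorem re_trace_conj_mul_adjoint_le (hA : DirectSum.IsInternal A)
    (hO : OrthogonalFamily 𝕜 (fun i => A i) fun i => (A i).subtypeₗᵢ) {r : ι → 𝕜} {C : ℝ}
    (hC : ∀ i j, A i ≠ ⊥ → A j ≠ ⊥ → ‖r i / r j‖ ≤ C) (δ : E ≃ₗ[𝕜] E)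
    (hδ : ∀ i, ∀ x ∈ A i, δ x = r i • x) (a : Module.End 𝕜 E) :
    RCLike.re (LinearMap.trace 𝕜 E (δ.conj a * LinearMap.adjoint (δ.conj a)))
      ≤ C ^ 2 * RCLike.re (LinearMap.trace 𝕜 E (a * LinearMap.adjoint a)) := by
  obtain ⟨b, k, hb⟩ := exists_orthonormalBasis_subordinate hA hO
  have ne_bot j : A (k j) ≠ ⊥ := (Submodule.ne_bot_iff _).2 ⟨b j, hb j, b.orthonormal.ne_zero j⟩
  have symm_apply j : δ.symm (b j) = (r (k j))⁻¹ • b j := by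
    have r_ne_zero : r (k j) ≠ 0 := fun h => b.orthonormal.ne_zero j <|
      δ.map_eq_zero_iff.1 <| by rw [hδ _ _ (hb j), h, zero_smul]
    rw [LinearEquiv.symm_apply_eq, map_smul, hδ _ _ (hb j), inv_smul_smul₀ r_ne_zero]
  have inner_apply i x : inner 𝕜 (b i) (δ x) = r (k i) * inner 𝕜 (b i) x := by
    have inner_comp : innerₛₗ 𝕜 (b i) ∘ₗ δ.toLinearMap = r (k i) • innerₛₗ 𝕜 (b i) := by
      refine b.toBasis.ext fun j => ?_
      rw [b.coe_toBasis, LinearMap.comp_apply, LinearEquiv.coe_coe, hδ _ _ (hb j), map_smul,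
        LinearMap.smul_apply, innerₛₗ_apply_apply, b.inner_eq_ite]
      split_ifs with hij
      · rw [hij]
      · rw [smul_zero, smul_zero]
    exact LinearMap.congr_fun inner_comp x
  have matrix_coeff i j : inner 𝕜 (b i) (δ.conj a (b j))
      = r (k i) / r (k j) * inner 𝕜 (b i) (a (b j)) := by
    rw [LinearEquiv.conj_apply_apply, inner_apply, symm_apply, map_smul, inner_smul_right,
      div_eq_mul_inv, mul_assoc]
  simp only [re_trace_mul_adjoint_self b, Finset.mul_sum]
  gcongr with j _ i _
  rw [matrix_coeff, norm_mul, mul_pow]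
  gcongr
  exact hC _ _ (ne_bot i) (ne_bot j)

end HilbertSchmidt

section TraceForm

variable {E E' : Type*} [AddCommGroup E] [Module ℂ E] [AddCommGroup E'] [Module ℂ E']

/-- The inner product `(x, y) ↦ ⟪T x, T y⟫` obtained by pulling back along an isomorphism `T`. -/
abbrev pullbackCore (c : InnerProductSpace.Core ℂ E) (T : E' ≃ₗ[ℂ] E) :
    InnerProductSpace.Core ℂ E' where
  inner x y := c.inner (T x) (T y)
  conj_inner_symm x y := c.conj_inner_symm (T x) (T y)
  re_inner_nonneg x := c.re_inner_nonneg (T x)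
  add_left x y z := by rw [map_add]; exact c.add_left (T x) (T y) (T z)
  smul_left x y r := by rw [map_smul]; exact c.smul_left (T x) (T y) r
  definite x hx := T.map_eq_zero_iff.1 (c.definite (T x) hx)

theorem pullbackCore_inner (c : InnerProductSpace.Core ℂ E) (T : E' ≃ₗ[ℂ] E) (x y : E') :
    (pullbackCore c T).inner x y = c.inner (T x) (T y) :=
  rfl

theorem core_inner_smul_smul (c : InnerProductSpace.Core ℂ E) (r s : ℂ) (x y : E) :
    c.inner (r • x) (s • y) = starRingEnd ℂ r * s * c.inner x y := by
  let _ : NormedAddCommGroup E := c.toNormedAddCommGroup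
  let _ : InnerProductSpace ℂ E := InnerProductSpace.ofCore c.toCore
  change inner ℂ (r • x) (s • y) = _ * inner ℂ x y
  rw [inner_smul_left, inner_smul_right, mul_assoc]

theorem traceForm_pullbackCore [FiniteDimensional ℂ E] [FiniteDimensional ℂ E']
    (c : InnerProductSpace.Core ℂ E) (T : E' ≃ₗ[ℂ] E) (a b : Module.End ℂ E') :
    traceForm (pullbackCore c T) a b = traceForm c (T.conj a) (T.conj b) := by
  let _ : NormedAddCommGroup E := c.toNormedAddCommGroup
  let _ : InnerProductSpace ℂ E := InnerProductSpace.ofCore c.toCore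
  let _ : NormedAddCommGroup E' := (pullbackCore c T).toNormedAddCommGroup
  let _ : InnerProductSpace ℂ E' := InnerProductSpace.ofCore (pullbackCore c T).toCore
  have adjoint_conj : T.conj (LinearMap.adjoint b) = LinearMap.adjoint (T.conj b) := by
    refine (LinearMap.eq_adjoint_iff _ _).2 fun x y => ?_
    obtain ⟨x, rfl⟩ := T.surjective x
    obtain ⟨y, rfl⟩ := T.surjective y
    simp only [LinearEquiv.conj_apply_apply, LinearEquiv.symm_apply_apply]
    exact LinearMap.adjoint_inner_left b y x
  change LinearMap.trace ℂ E' (a * LinearMap.adjoint b)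
    = LinearMap.trace ℂ E (T.conj a * LinearMap.adjoint (T.conj b))
  rw [← adjoint_conj, ← LinearMap.trace_conj' _ T]
  exact congrArg _ (LinearEquiv.conj_comp T _ _)

theorem re_traceForm_conj_le {ι : Type*} [DecidableEq ι] [FiniteDimensional ℂ E]
    (c : InnerProductSpace.Core ℂ E) {A : ι → Submodule ℂ E} (hA : DirectSum.IsInternal A)
    (hO : ∀ i j, i ≠ j → ∀ x ∈ A i, ∀ y ∈ A j, c.inner x y = 0) {r : ι → ℂ} {C : ℝ}
    (hC : ∀ i j, A i ≠ ⊥ → A j ≠ ⊥ → ‖r i / r j‖ ≤ C) (δ : E ≃ₗ[ℂ] E)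
    (hδ : ∀ i, ∀ x ∈ A i, δ x = r i • x) (a : Module.End ℂ E) :
    (traceForm c (δ.conj a) (δ.conj a)).re ≤ C ^ 2 * (traceForm c a a).re := by
  let _ : NormedAddCommGroup E := c.toNormedAddCommGroup
  let _ : InnerProductSpace ℂ E := InnerProductSpace.ofCore c.toCore
  exact re_trace_conj_mul_adjoint_le hA (fun i j hij x y => hO i j hij x x.2 y y.2) hC δ hδ a

end TraceForm

section Scale

variable {K E ι : Type*} [Field K] [AddCommGroup E] [Module K E] [DecidableEq ι]
  {A : ι → Submodule K E}

/-- The automorphism which acts on the summand `A i` of `E` as multiplication by `r i`. -/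
def scaleEquiv (hA : DirectSum.IsInternal A) (r : ι → K) (hr : ∀ i, r i ≠ 0) : E ≃ₗ[K] E :=
  let e := LinearEquiv.ofBijective (DirectSum.coeLinearMap A) hA
  e.symm ≪≫ₗ DFinsupp.mapRange.linearEquiv (fun i => LinearEquiv.smulOfNeZero K (A i) (r i) (hr i))
    ≪≫ₗ e

theorem scaleEquiv_apply (hA : DirectSum.IsInternal A) (r : ι → K) (hr : ∀ i, r i ≠ 0)
    {i : ι} {x : E} (hx : x ∈ A i) : scaleEquiv hA r hr x = r i • x := by
  let e := LinearEquiv.ofBijective (DirectSum.coeLinearMap A) hA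
  have e_single (y : A i) : e (DirectSum.lof K ι (fun i => A i) i y) = y :=
    DirectSum.coeLinearMap_lof A i y
  have symm_apply : e.symm x = DirectSum.lof K ι (fun i => A i) i ⟨x, hx⟩ :=
    e.symm_apply_eq.2 (e_single ⟨x, hx⟩).symm
  change e (DirectSum.lmap (fun i => (r i • LinearMap.id : A i →ₗ[K] A i)) (e.symm x)) = _
  rw [symm_apply, DirectSum.lmap_lof, e_single]
  rfl

end Scale

namespace Data

variable {V : Type*} [AddCommGroup V] [Module ℝ V] {D : Data V} {c : ℤ → ℝ} {g : V ≃ₗ[ℝ] V}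
  {F : ℤ → Submodule ℂ (Cx V)} {I : ℤ → ℤ → Submodule ℂ (Cx V)}

theorem act_mem_M (hg : IsWeightScaling D.W c g) (hF : F ∈ D.M) :
    act (cxEquiv g).toLinearMap F ∈ D.M := by
  obtain ⟨hanti, ⟨p, hp⟩, ⟨q, hq⟩, hgr⟩ := hF
  refine ⟨fun a b hab => Submodule.map_mono (hanti hab), ⟨p, ?_⟩, ⟨q, ?_⟩, ?_⟩
  · rw [act, hp, Submodule.map_top, LinearEquiv.range]
  · rw [act, hq, Submodule.map_bot]
  · rwa [hg.grFiltration_act]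

theorem IsDeligneBigrading.map (hI : D.IsDeligneBigrading F I) (hg : IsWeightScaling D.W c g) :
    D.IsDeligneBigrading (act (cxEquiv g).toLinearMap F)
      (fun p => act (cxEquiv g).toLinearMap (I p)) where
  isInternal := by
    have hI' := hI.isInternal
    rw [DirectSum.isInternal_submodule_iff_iSupIndep_and_iSup_eq_top] at hI' ⊢
    refine ⟨hI'.1.map_orderIso (Submodule.orderIsoMapComap (cxEquiv g)), ?_⟩
    simp only [act]
    rw [← Submodule.map_iSup, hI'.2, Submodule.map_top, LinearEquiv.range]
  hodge p := by
    simp only [act, hI.hodge p, Submodule.map_iSup]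
  weight k := by
    rw [← hg.map_baseChange, hI.weight k]
    simp only [act, Submodule.map_iSup]
  conj_mod p q := by
    have h := congrArg (Submodule.map (cxEquiv g).toLinearMap) (hI.conj_mod p q)
    simpa only [act, Submodule.map_sup, Submodule.map_iSup, conjSubspace_map_cxEquiv] using h

theorem IsInLieAlgebra.conj {X : Module.End ℂ (Cx V)} (hX : D.IsInLieAlgebra X)
    (hg : IsWeightScaling D.W c g) : D.IsInLieAlgebra ((cxEquiv g).conj X) := by
  refine ⟨fun w => ?_, fun w u v u' v' hu hv => ?_⟩
  · rw [← hg.map_baseChange w]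
    rintro _ ⟨_, ⟨x, hx, rfl⟩, rfl⟩
    rw [LinearEquiv.coe_coe, LinearEquiv.conj_apply_apply, LinearEquiv.symm_apply_apply]
    exact Submodule.mem_map_of_mem (hX.1 w (Submodule.mem_map_of_mem hx))
  · obtain ⟨u, rfl⟩ := (cxEquiv (hg.restrict w)).surjective u
    obtain ⟨v, rfl⟩ := (cxEquiv (hg.restrict w)).surjective v
    obtain ⟨u', rfl⟩ := (cxEquiv (hg.restrict w)).surjective u'
    obtain ⟨v', rfl⟩ := (cxEquiv (hg.restrict w)).surjective v'
    simp only [hg.incl_restrict, LinearEquiv.conj_apply_apply, LinearEquiv.symm_apply_apply,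
      EmbeddingLike.apply_eq_iff_eq] at hu hv
    rw [hg.baseChange_gr_restrict, hg.baseChange_gr_restrict, ← mul_add,
      hX.2 w u v u' v' hu hv, mul_zero]

theorem conj_mem_tangentModel {v : Module.End ℂ (Cx V)} (hv : v ∈ D.tangentModel I)
    (hg : IsWeightScaling D.W c g) :
    (cxEquiv g).conj v ∈ D.tangentModel (fun p => act (cxEquiv g).toLinearMap (I p)) := by
  unfold tangentModel at hv
  induction hv using Submodule.span_induction with
  | mem X hX =>
    refine Submodule.subset_span ?_
    simp only [mem_iUnion] at hX ⊢
    obtain ⟨p, q, hpq, hX, hXI⟩ := hX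
    refine ⟨p, q, hpq, hX.conj hg, fun a b => ?_⟩
    rintro _ ⟨_, ⟨x, hx, rfl⟩, rfl⟩
    rw [LinearEquiv.coe_coe, LinearEquiv.conj_apply_apply, LinearEquiv.symm_apply_apply]
    exact Submodule.mem_map_of_mem (hXI a b (Submodule.mem_map_of_mem hx))
  | zero => rw [map_zero]; exact Submodule.zero_mem _
  | add X X' _ _ hX hX' => rw [map_add]; exact Submodule.add_mem _ hX hX'
  | smul r X _ hX => rw [map_smul]; exact Submodule.smul_mem _ r hX

theorem conj_mem_GC {k : Cx V ≃ₗ[ℂ] Cx V} (hk : k ∈ D.GC) (hg : IsWeightScaling D.W c g) :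
    (cxEquiv g).symm ≪≫ₗ k ≪≫ₗ cxEquiv g ∈ D.GC := by
  refine ⟨fun w => ?_, fun w u v u' v' hu hv => ?_⟩
  · rw [LinearEquiv.coe_trans, LinearEquiv.coe_trans, Submodule.map_comp, Submodule.map_comp,
      (Submodule.map_symm_eq_iff (cxEquiv g)).2 (hg.map_baseChange w), hk.1, hg.map_baseChange]
  · obtain ⟨u, rfl⟩ := (cxEquiv (hg.restrict w)).surjective u
    obtain ⟨v, rfl⟩ := (cxEquiv (hg.restrict w)).surjective v
    obtain ⟨u', rfl⟩ := (cxEquiv (hg.restrict w)).surjective u'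
    obtain ⟨v', rfl⟩ := (cxEquiv (hg.restrict w)).surjective v'
    simp only [hg.incl_restrict, LinearEquiv.trans_apply, LinearEquiv.symm_apply_apply,
      EmbeddingLike.apply_eq_iff_eq] at hu hv
    rw [hg.baseChange_gr_restrict, hg.baseChange_gr_restrict, hk.2 w u v u' v' hu hv]

theorem HasVelocity.act {γ : ℝ → ℤ → Submodule ℂ (Cx V)} {u : ℝ} {v : Module.End ℂ (Cx V)}
    (h : D.HasVelocity γ u v) (hg : IsWeightScaling D.W c g) :
    D.HasVelocity (fun t => act (cxEquiv g).toLinearMap (γ t)) u ((cxEquiv g).conj v) := by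
  obtain ⟨k, hk, hku, hsmooth, hderiv⟩ := h
  refine ⟨fun t => (cxEquiv g).symm ≪≫ₗ k t ≪≫ₗ cxEquiv g, ?_, ?_, fun φ x => ?_,
    fun φ x => ?_⟩
  · filter_upwards [hk] with t ⟨hkt, hγt⟩
    refine ⟨conj_mem_GC hkt hg, ?_⟩
    have comp_conj : ((cxEquiv g).symm ≪≫ₗ k t ≪≫ₗ cxEquiv g).toLinearMap ∘ₗ
        (cxEquiv g).toLinearMap = (cxEquiv g).toLinearMap ∘ₗ (k t).toLinearMap :=
      LinearMap.ext fun x => by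
        simp only [LinearMap.comp_apply, LinearEquiv.coe_coe, LinearEquiv.trans_apply,
          LinearEquiv.symm_apply_apply]
    funext p
    simp only [hγt, MixedHodge.act, ← Submodule.map_comp, comp_conj]
  · simp only [hku]
    exact (cxEquiv g).symm_trans_self
  · exact hsmooth (φ ∘ₗ (cxEquiv g).toLinearMap) ((cxEquiv g).symm x)
  · exact hderiv (φ ∘ₗ (cxEquiv g).toLinearMap) ((cxEquiv g).symm x)

theorem IsMixedHodgeMetric.map {m : InnerProductSpace.Core ℂ (Cx V)}
    (hm : D.IsMixedHodgeMetric I m) (hg : IsWeightScaling D.W c g) {δ : Cx V ≃ₗ[ℂ] Cx V}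
    (hδ : ∀ p q, ∀ x ∈ I p q, δ x = (c (p + q) : ℂ) • x) :
    D.IsMixedHodgeMetric (fun p => MixedHodge.act (cxEquiv g).toLinearMap (I p))
      (pullbackCore m ((cxEquiv g).symm ≪≫ₗ δ)) where
  orthogonal := by
    rintro p q p' q' hne _ ⟨u, hu, rfl⟩ _ ⟨v, hv, rfl⟩
    simp only [pullbackCore_inner, LinearEquiv.coe_coe, LinearEquiv.trans_apply,
      LinearEquiv.symm_apply_apply]
    rw [hδ _ _ _ hu, hδ _ _ _ hv, core_inner_smul_smul,
      hm.orthogonal p q p' q' hne u hu v hv, mul_zero]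
  inner_eq p q u v hu hv := by
    obtain ⟨u, rfl⟩ := (cxEquiv (hg.restrict (p + q))).surjective u
    obtain ⟨v, rfl⟩ := (cxEquiv (hg.restrict (p + q))).surjective v
    simp only [MixedHodge.act, hg.incl_restrict, Submodule.mem_map_equiv,
      LinearEquiv.symm_apply_apply] at hu hv
    simp only [pullbackCore_inner, hg.incl_restrict, LinearEquiv.trans_apply,
      LinearEquiv.symm_apply_apply, conj_cxEquiv]
    rw [hδ _ _ _ hu, hδ _ _ _ hv, core_inner_smul_smul, hm.inner_eq p q _ _ hu hv,
      hg.baseChange_gr_restrict, Complex.conj_ofReal]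
    ring

theorem IsDeligneBigrading.add_le_of_weight_eq_top (hI : D.IsDeligneBigrading F I) {p q m : ℤ}
    (hpq : I p q ≠ ⊥) (hm : D.W m = ⊤) : p + q ≤ m := by
  by_contra! hlt
  have disjoint_others := hI.isInternal.submodule_iSupIndep (p, q)
  have others_eq_top : (⨆ (j : ℤ × ℤ) (_ : j ≠ (p, q)), I j.1 j.2) = ⊤ := by
    rw [← top_le_iff, ← Submodule.baseChange_top, ← hm, hI.weight]
    refine iSup_le fun a => iSup_le fun b => iSup_le fun hab => ?_
    refine le_iSup₂_of_le (f := fun (j : ℤ × ℤ) (_ : j ≠ (p, q)) => I j.1 j.2) (a, b) ?_ le_rfl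
    rintro ⟨⟩
    exact hab.not_gt hlt
  rw [others_eq_top, disjoint_top] at disjoint_others
  exact hpq disjoint_others

theorem IsDeligneBigrading.lt_add_of_weight_eq_bot (hI : D.IsDeligneBigrading F I) {p q m : ℤ}
    (hpq : I p q ≠ ⊥) (hm : D.W m = ⊥) : m < p + q := by
  by_contra! hle
  refine hpq (eq_bot_iff.2 ?_)
  rw [← Submodule.baseChange_bot, ← hm, hI.weight]
  exact le_iSup_of_le p (le_iSup₂_of_le q hle le_rfl)

theorem IsDeligneBigrading.sub_le_filtrationLength_sub_one (hI : D.IsDeligneBigrading F I)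
    {p q p' q' : ℤ} (h : I p q ≠ ⊥) (h' : I p' q' ≠ ⊥) :
    p + q - (p' + q') ≤ filtrationLength D.W - 1 := by
  have le_sInf : p + q ≤ sInf {k | D.W k = ⊤} :=
    le_csInf D.exists_top fun m hm => hI.add_le_of_weight_eq_top h hm
  have sSup_le : sSup {k | D.W k = ⊥} ≤ p' + q' - 1 :=
    csSup_le D.exists_bot fun m hm => Int.le_sub_one_of_lt (hI.lt_add_of_weight_eq_bot h' hm)
  unfold filtrationLength
  omega

variable [FiniteDimensional ℝ V]

theorem HasSpeed.act {γ : ℝ → ℤ → Submodule ℂ (Cx V)} {u s C : ℝ} (h : D.HasSpeed γ u s)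
    (hg : IsWeightScaling D.W c g) (hC₀ : 0 ≤ C)
    (hC : ∀ k l : ℤ, |k - l| ≤ filtrationLength D.W - 1 → |c k / c l| ≤ C) :
    ∃ s' ≤ C * s, D.HasSpeed (fun t => act (cxEquiv g).toLinearMap (γ t)) u s' := by
  obtain ⟨I, m, v, hI, hm, hv, hvel, rfl⟩ := h
  let δ := scaleEquiv hI.isInternal (fun pq => (c (pq.1 + pq.2) : ℂ))
    fun _ => Complex.ofReal_ne_zero.2 (hg.ne_zero _)
  have hδ (pq : ℤ × ℤ) (x) (hx : x ∈ I pq.1 pq.2) : δ x = (c (pq.1 + pq.2) : ℂ) • x :=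
    scaleEquiv_apply hI.isInternal _ _ hx
  have conj_conj : ((cxEquiv g).symm ≪≫ₗ δ).conj ((cxEquiv g).conj v) = δ.conj v :=
    LinearMap.ext fun x => by
      simp only [LinearEquiv.conj_apply_apply, LinearEquiv.trans_apply,
        LinearEquiv.symm_apply_apply, LinearEquiv.symm_trans_apply, LinearEquiv.symm_symm]
  refine ⟨_, ?_, _, _, _, hI.map hg, hm.map hg fun p q => hδ (p, q), conj_mem_tangentModel hv hg,
    hvel.act hg, rfl⟩
  rw [traceForm_pullbackCore, conj_conj, ← Real.sqrt_sq hC₀, ← Real.sqrt_mul (sq_nonneg C)]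
  refine Real.sqrt_le_sqrt <| re_traceForm_conj_le m hI.isInternal
    (fun i j hij x hx y hy => hm.orthogonal _ _ _ _ hij.symm y hy x hx)
    (fun i j hi hj => ?_) δ hδ v
  rw [← Complex.ofReal_div, Complex.norm_real]
  refine hC _ _ (abs_sub_le_iff.2 ⟨?_, ?_⟩)
  exacts [hI.sub_le_filtrationLength_sub_one hi hj, hI.sub_le_filtrationLength_sub_one hj hi]

theorem dist_act_le (hg : IsWeightScaling D.W c g) {C : ℝ} (hC₀ : 0 < C)
    (hC : ∀ k l : ℤ, |k - l| ≤ filtrationLength D.W - 1 → |c k / c l| ≤ C)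
    (F F' : ℤ → Submodule ℂ (Cx V)) :
    D.dist (act (cxEquiv g).toLinearMap F) (act (cxEquiv g).toLinearMap F')
      ≤ ENNReal.ofReal C * D.dist F F' := by
  conv_rhs => rw [dist]
  simp only [ENNReal.mul_iInf_of_ne (ENNReal.ofReal_pos.2 hC₀).ne' ENNReal.ofReal_ne_top]
  refine le_iInf fun γ => le_iInf fun s => le_iInf fun ⟨hγ₀, hγ₁, hγ⟩ => ?_
  choose! s' hs' hspeed using fun u (hu : u ∈ Icc (0 : ℝ) 1) => (hγ u hu).2.act hg hC₀.le hC
  calc D.dist (act (cxEquiv g).toLinearMap F) (act (cxEquiv g).toLinearMap F')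
    _ ≤ ∫⁻ u in Icc (0 : ℝ) 1, ENNReal.ofReal (s' u) :=
      iInf₂_le_of_le (fun t => act (cxEquiv g).toLinearMap (γ t)) s' <|
        iInf_le _ ⟨congrArg (act _) hγ₀, congrArg (act _) hγ₁, fun u hu =>
          ⟨act_mem_M hg (hγ u hu).1, hspeed u hu⟩⟩
    _ ≤ ∫⁻ u in Icc (0 : ℝ) 1, ENNReal.ofReal C * ENNReal.ofReal (s u) := by
      refine MeasureTheory.setLIntegral_mono' measurableSet_Icc fun u hu => ?_
      rw [← ENNReal.ofReal_mul hC₀.le]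
      exact ENNReal.ofReal_le_ofReal (hs' u hu)
    _ = ENNReal.ofReal C * ∫⁻ u in Icc (0 : ℝ) 1, ENNReal.ofReal (s u) :=
      MeasureTheory.lintegral_const_mul' _ _ ENNReal.ofReal_ne_top

end Data

end MixedHodge

end

theorem mainTheorem10_general {V : Type*} [AddCommGroup V] [Module ℝ V] [FiniteDimensional ℝ V]
    [Nontrivial V] (D : MixedHodge.Data V) (Y : Module.End ℝ V)
    (hY : MixedHodge.IsRealGrading D.W Y) (r : ℝ)
    (F F' : ℤ → Submodule ℂ (MixedHodge.Cx V)) (hF : F ∈ D.M) (hF' : F' ∈ D.M) :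
    MixedHodge.act ((MixedHodge.expEnd (r • Y)).baseChange ℂ) F ∈ D.M ∧
    MixedHodge.act ((MixedHodge.expEnd (r • Y)).baseChange ℂ) F' ∈ D.M ∧
    D.dist (MixedHodge.act ((MixedHodge.expEnd (r • Y)).baseChange ℂ) F)
        (MixedHodge.act ((MixedHodge.expEnd (r • Y)).baseChange ℂ) F')
      ≤ ENNReal.ofReal (Real.exp (|r| * ((MixedHodge.filtrationLength D.W : ℝ) - 1)))
        * D.dist F F' := by
  have hg := hY.isWeightScaling_expEquiv_smul D.exists_bot r
  rw [← MixedHodge.toLinearMap_cxEquiv_expEquiv]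
  refine ⟨MixedHodge.Data.act_mem_M hg hF, MixedHodge.Data.act_mem_M hg hF',
    MixedHodge.Data.dist_act_le hg (Real.exp_pos _) (fun k l hkl => ?_) F F'⟩
  have hkl' : |(k : ℝ) - l| ≤ (MixedHodge.filtrationLength D.W : ℝ) - 1 := by exact_mod_cast hkl
  rw [← Real.exp_sub, Real.abs_exp, Real.exp_le_exp, ← mul_sub]
  calc r * (k - l) ≤ |r| * |(k : ℝ) - l| := (le_abs_self _).trans_eq (abs_mul _ _)
    _ ≤ |r| * ((MixedHodge.filtrationLength D.W : ℝ) - 1) := by gcongr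

theorem mainTheorem10 {V : Type*} [AddCommGroup V] [Module ℝ V] [FiniteDimensional ℝ V]
    [Nontrivial V] (D : MixedHodge.Data V) (Y : Module.End ℝ V)
    (hY : MixedHodge.IsRealGrading D.W Y) (α y : ℝ) (hα : α < 0) (hy : 1 < y)
    (F F' : ℤ → Submodule ℂ (MixedHodge.Cx V)) (hF : F ∈ D.M) (hF' : F' ∈ D.M) :
    MixedHodge.act ((MixedHodge.powEnd y (α • Y)).baseChange ℂ) F ∈ D.M ∧
    MixedHodge.act ((MixedHodge.powEnd y (α • Y)).baseChange ℂ) F' ∈ D.M ∧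
    D.dist (MixedHodge.act ((MixedHodge.powEnd y (α • Y)).baseChange ℂ) F)
        (MixedHodge.act ((MixedHodge.powEnd y (α • Y)).baseChange ℂ) F')
      ≤ ENNReal.ofReal (y ^ (-α * ((MixedHodge.filtrationLength D.W : ℝ) - 1)))
        * D.dist F F' := by
  rw [MixedHodge.powEnd, smul_smul, Real.rpow_def_of_pos (one_pos.trans hy), ← mul_assoc,
    mul_neg, ← abs_of_neg (mul_neg_of_pos_of_neg (Real.log_pos hy) hα)]
  exact mainTheorem10_general D Y hY _ F F' hF hF'
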